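/- Let $k$ be an algebraically closed field of characteristic $p>2$ with $p\not\equiv 1 \pmod 3$, and let $d>1$ be an integer with $p\nmid d(d+2)(d^2+d+1)$. The Jouanolou foliation $\mathcal{J}_d$ of degree $d$ on $\mathbb{P}^2_k$ is the one given by the projective $1$-form $$\omega=(x^dz-y^{d+1})\,dx+(xy^d-z^{d+1})\,dy+(z^dy-x^{d+1})\,dz .$$ Let $\mathcal{F}$ be a foliation of degree $d$ on $\mathbb{P}^2_k$, given by a projective $1$-form $\omega=A\,dx+B\,dy+C\,dz$ with $A,B,C$ homogeneous of degree $d+1$, $Ax+By+Cz=0$ and $\mathcal{Z}(A,B,C)\subset\mathbb{P}^2_k$ finite. Since $p\nmid d+2$, one can write $d\omega=(d+2)(L\,dy\wedge dz-M\,dx\wedge dz+N\,dx\wedge dy)$; put $v_\omega=L\,\partial_x+M\,\partial_y+N\,\partial_z$. The foliation $\mathcal{F}$ is called $p$-closed if the contraction $i_{v_\omega^p}\omega=A\,v_\omega^p(x)+B\,v_\omega^p(y)+C\,v_\omega^p(z)$ is zero, where $v_\omega^p$ is the $p$-th iterate of the derivation $v_\omega$ of $k[x,y,z]$. Then the Jouanolou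 foliation $\mathcal{J}_d$ is not $p$-closed. -/

import Mathlib

open MvPolynomial

/-- A homogeneous polynomial `1`-form `ω = A dx + B dy + C dz` on affine `3`-space, given by its
coefficients `(A, B, C)`; the variables `x, y, z` are `X 0, X 1, X 2`. -/
abbrev OneForm (k : Type*) [Field k] : Type _ := Fin 3 → MvPolynomial (Fin 3) k

/-- The singular locus `Z(A, B, C)` in the projective plane. It does not depend on the chosen
representative of a point when `A, B, C` are homogeneous of the same degree. -/
def OneForm.sing {k : Type*} [Field k] (ω : OneForm k) : Set (Projectivization k (Fin 3 → k)) :=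
  {P | ∀ i, eval P.rep (ω i) = 0}

/-- A foliation of degree `d` on the projective plane over `k` (an algebraically closed field):
a nonzero projective `1`-form `ω = A dx + B dy + C dz`, with `A, B, C` homogeneous of degree
`d + 1`, with `A x + B y + C z = 0` and with finite singular locus.
(Proportional forms define the same foliation; we keep a defining form, and the notions below are
unchanged when it is multiplied by a nonzero constant.) -/
structure PlaneFoliation (k : Type*) [Field k] (d : ℕ) where
  form : OneForm k
  isHomogeneous : ∀ i, (form i).IsHomogeneous (d + 1)
  euler : ∑ i, form i * X i = 0
  ne_zero : form ≠ 0
  finite_sing : form.sing.Finite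

namespace PlaneFoliation

variable {k : Type*} [Field k] {d : ℕ}

/-- The homogeneous vector field `v_ω = L ∂x + M ∂y + N ∂z`, as a derivation of `k[x, y, z]`,
determined by `dω = (d + 2) (L dy ∧ dz - M dx ∧ dz + N dx ∧ dy)`.
This is meaningful when `d + 2` is nonzero in `k`. -/
noncomputable def vectorField (F : PlaneFoliation k d) :
    Derivation k (MvPolynomial (Fin 3) k) (MvPolynomial (Fin 3) k) :=
  mkDerivation k ![
    ((d : k) + 2)⁻¹ • (pderiv 1 (F.form 2) - pderiv 2 (F.form 1)),
    ((d : k) + 2)⁻¹ • (pderiv 2 (F.form 0) - pderiv 0 (F.form 2)),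
    ((d : k) + 2)⁻¹ • (pderiv 0 (F.form 1) - pderiv 1 (F.form 0))]

/-- The contraction `i_{v^p} ω = A v^p(x) + B v^p(y) + C v^p(z)` of `ω` with the `p`-th iterate
of `v = v_ω` (in characteristic `p` this iterate is again a derivation, i.e. a vector field). -/
noncomputable def pContraction (F : PlaneFoliation k d) (p : ℕ) : MvPolynomial (Fin 3) k :=
  ∑ i, F.form i * (F.vectorField)^[p] (X i)

/-- The foliation, over a field of characteristic `p` not dividing `d + 2`, is `p`-closed if
`i_{v_ω^p} ω = 0`. -/
def IsPClosed (F : PlaneFoliation k d) (p : ℕ) : Prop := F.pContraction p = 0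

end PlaneFoliation

/-- The form
`(x^d z - y^(d+1)) dx + (x y^d - z^(d+1)) dy + (z^d y - x^(d+1)) dz`. -/
noncomputable def jouanolouForm (k : Type*) [Field k] (d : ℕ) : OneForm k :=
  ![X 0 ^ d * X 2 - X 1 ^ (d + 1),
    X 0 * X 1 ^ d - X 2 ^ (d + 1),
    X 2 ^ d * X 1 - X 0 ^ (d + 1)]

theorem jouanolouForm_isHomogeneous (k : Type*) [Field k] (d : ℕ) (i : Fin 3) :
    (jouanolouForm k d i).IsHomogeneous (d + 1) := by
  have hX : ∀ (j : Fin 3) (n : ℕ), ((X j : MvPolynomial (Fin 3) k) ^ n).IsHomogeneous n :=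
    fun j n => isHomogeneous_X_pow j n
  have h1 : ∀ j : Fin 3, (X j : MvPolynomial (Fin 3) k).IsHomogeneous 1 := isHomogeneous_X k
  fin_cases i
  · exact ((hX 0 d).mul (h1 2)).sub (hX 1 (d + 1))
  · have h := (h1 0).mul (hX 1 d)
    rw [add_comm] at h
    exact h.sub (hX 2 (d + 1))
  · exact ((hX 2 d).mul (h1 1)).sub (hX 0 (d + 1))

theorem jouanolouForm_euler (k : Type*) [Field k] (d : ℕ) :
    ∑ i, jouanolouForm k d i * X i = 0 := by
  simp [Fin.sum_univ_three, jouanolouForm]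
  ring

theorem jouanolouForm_ne_zero (k : Type*) [Field k] (d : ℕ) : jouanolouForm k d ≠ 0 := by
  intro h
  have h0 := congrArg (eval ![(0 : k), 1, 0]) (congrFun h 0)
  simp [jouanolouForm] at h0

theorem jouanolouForm_finite_sing (k : Type*) [Field k] (d : ℕ) :
    (jouanolouForm k d).sing.Finite := by
  have hfin : {t : k | t ^ (d ^ 2 + d + 1) = 1}.Finite := by
    classical
    have := (Polynomial.nthRoots (d ^ 2 + d + 1) (1 : k)).toFinset.finite_toSet
    refine this.subset fun t ht => ?_
    simpa [Polynomial.mem_nthRoots] using ht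
  refine (hfin.image fun t => Projectivization.mk k (![(t ^ d)⁻¹, t, 1] : Fin 3 → k)
    fun h => one_ne_zero (congrFun h 2)).subset ?_
  intro P hP
  have h0 := hP 0
  have h1 := hP 1
  have h2 := hP 2
  obtain ⟨v, hv⟩ : ∃ v, v = P.rep := ⟨_, rfl⟩
  have hne : v ≠ 0 := hv ▸ P.rep_nonzero
  have hPm : Projectivization.mk k v hne = P := by
    subst hv
    exact P.mk_rep
  rw [← hv] at h0 h1 h2
  simp [jouanolouForm, sub_eq_zero] at h0 h1 h2
  have hz : v 2 ≠ 0 := by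
    intro hz
    have hy : v 1 = 0 := by
      rw [hz, mul_zero] at h0
      exact pow_eq_zero_iff (Nat.succ_ne_zero d) |>.1 h0.symm
    have hx : v 0 = 0 := by
      rw [hy, mul_zero] at h2
      exact pow_eq_zero_iff (Nat.succ_ne_zero d) |>.1 h2.symm
    apply hne
    ext i
    fin_cases i <;> simp [hx, hy, hz]
  have hx : v 0 ≠ 0 := by
    intro hx
    rw [hx, zero_mul] at h1
    exact pow_ne_zero _ hz h1.symm
  have hy : v 1 ≠ 0 := by
    intro hy
    rw [hy, mul_zero] at h2
    exact pow_ne_zero _ hx h2.symm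
  have ha : v 0 / v 2 * (v 1 / v 2) ^ d = 1 := by
    rw [div_pow, div_mul_div_comm, h1, pow_succ']
    exact div_self (mul_ne_zero hz (pow_ne_zero _ hz))
  have hb : (v 0 / v 2) ^ d = (v 1 / v 2) ^ (d + 1) := by
    rw [div_pow, div_pow, ← h0]
    field_simp
    ring
  have hx' : v 0 / v 2 = ((v 1 / v 2) ^ d)⁻¹ := eq_inv_of_mul_eq_one_left ha
  refine ⟨v 1 / v 2, ?_, ?_⟩
  · have h3 : (v 0 / v 2 * (v 1 / v 2) ^ d) ^ d = 1 := by rw [ha, one_pow]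
    rw [mul_pow, hb] at h3
    change (v 1 / v 2) ^ (d ^ 2 + d + 1) = 1
    rw [← h3]
    ring
  · rw [← hPm, Projectivization.mk_eq_mk_iff']
    refine ⟨(v 2)⁻¹, ?_⟩
    ext i
    fin_cases i
    · simp only [← hx']
      simp [div_eq_inv_mul]
    · simp [div_eq_inv_mul]
    · simp [hz]

/-- The Jouanolou foliation of degree `d`. -/
noncomputable def jouanolou (k : Type*) [Field k] (d : ℕ) : PlaneFoliation k d where
  form := jouanolouForm k d
  isHomogeneous := jouanolouForm_isHomogeneous k d
  euler := jouanolouForm_euler k d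
  ne_zero := jouanolouForm_ne_zero k d
  finite_sing := jouanolouForm_finite_sing k d

/-! Up to normalization `v` sends x, y, z to z^d, x^d, y^d, so the line x = y = z is invariant. Let
I be its ideal and d = e + 1. Modulo I², `v` acts on the linear forms in x - y, y - z as d z^e times
an order-three map σ (`cycle`), and modulo I it sends z^m to m z^(m+e). Hence `v^[n]` acts on these
forms as z^(ne) ∏_{j<n} (dσ + je), and the same product at T = 1 gives `v^[n]` of z modulo I. For n
= p the product is T^p - e^(p-1) T, so only σ^p and σ matter. On the curve (1 + ε, 1, 1) the
contraction is divisible by ε², and these data determine its ε² coefficient. The terms in e^(p-1)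
cancel, leaving ±d(d + 2) ≠ 0 when p = 3 or p ≡ 2 mod 3; for p ≡ 1 mod 3 one has σ^p = σ and the
coefficient would vanish. -/

namespace Jouanolou

variable {k : Type*} [Field k]

/-! ### The product over the prime field -/

/-- In characteristic `p`, the product of `X + j s` over `j < p` is `X ^ p - s ^ (p - 1) X`. -/
theorem prod_X_add_natCast_mul (p : ℕ) [CharP k p] (hp : p.Prime) (s : k) :
    ∏ j ∈ Finset.range p, ((Polynomial.X : Polynomial k) + Polynomial.C ((j : k) * s)) =
      Polynomial.X ^ p - Polynomial.C (s ^ (p - 1)) * Polynomial.X := by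
  have := Fact.mk hp
  by_cases hs : s = 0
  · subst hs
    have : p - 1 ≠ 0 := by have := hp.two_le; omega
    simp [this]
  have hinj : Set.InjOn (fun j : ℕ => -((j : k) * s)) (Finset.range p) := by
    intro i hi j hj hij
    simp only [Finset.coe_range, Set.mem_Iio] at hi hj
    have h1 : (i : k) = j := mul_right_cancel₀ hs (neg_injective hij)
    exact CharP.natCast_injOn_Iio k p hi hj h1
  have hmon : (Polynomial.X ^ p - Polynomial.C (s ^ (p - 1)) * Polynomial.X :
      Polynomial k).Monic := by
    refine Polynomial.monic_X_pow_sub ((Polynomial.degree_C_mul_X_le _).trans_lt ?_)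
    exact_mod_cast hp.one_lt
  have hdeg : (Polynomial.X ^ p - Polynomial.C (s ^ (p - 1)) * Polynomial.X :
      Polynomial k).natDegree = p := by
    refine Polynomial.natDegree_eq_of_degree_eq_some ?_
    rw [Polynomial.degree_sub_eq_left_of_degree_lt, Polynomial.degree_X_pow]
    rw [Polynomial.degree_X_pow]
    exact (Polynomial.degree_C_mul_X_le _).trans_lt (by exact_mod_cast hp.one_lt)
  have hprod : ∏ j ∈ Finset.range p,
      ((Polynomial.X : Polynomial k) + Polynomial.C ((j : k) * s)) =
      ∏ j ∈ Finset.range p, (Polynomial.X - Polynomial.C (-((j : k) * s))) := by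
    simp
  -- The p distinct roots -js of the product are roots of the right side, and both sides are monic
  -- of degree p.
  refine (Polynomial.eq_of_monic_of_dvd_of_natDegree_le ?_ hmon ?_ ?_).symm
  · exact Polynomial.monic_prod_of_monic _ _ fun j _ => Polynomial.monic_X_add_C _
  · rw [hprod]
    refine Finset.prod_dvd_of_coprime ?_ ?_
    · intro i hi j hj hij
      exact Polynomial.isCoprime_X_sub_C_of_isUnit_sub
        (sub_ne_zero.2 fun h => hij (hinj hi hj h)).isUnit
    · intro j _
      rw [Polynomial.dvd_iff_isRoot]
      have hj : (j : k) ^ p = j := by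
        rw [← frobenius_def, map_natCast]
      have hsp : s ^ (p - 1) * s = s ^ p := pow_sub_one_mul hp.ne_zero s
      have hn : (-((j : k) * s)) ^ p = -(((j : k) * s) ^ p) := by
        simpa [frobenius_def] using map_neg (frobenius k p) ((j : k) * s)
      simp only [Polynomial.IsRoot.def, Polynomial.eval_sub, Polynomial.eval_pow,
        Polynomial.eval_X, Polynomial.eval_mul, Polynomial.eval_C, hn]
      rw [mul_pow, hj, ← hsp]
      ring
  · rw [hdeg, hprod, Polynomial.natDegree_prod_of_monic _ _ fun j _ => Polynomial.monic_X_sub_C _]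
    simp only [Polynomial.natDegree_X_sub_C, Finset.sum_const, Finset.card_range, smul_eq_mul,
      mul_one, le_refl]

/-! ### The invariant diagonal -/

/-- The ideal of the line `x = y = z`. -/
noncomputable def diagIdeal (k : Type*) [Field k] : Ideal (MvPolynomial (Fin 3) k) :=
  Ideal.span {X 0 - X 1, X 1 - X 2}

/-- The linear form `u.1 (x - y) + u.2 (y - z)`. -/
noncomputable def linForm (u : k × k) : MvPolynomial (Fin 3) k :=
  C u.1 * (X 0 - X 1) + C u.2 * (X 1 - X 2)

/-- The endomorphism of the space spanned by `a = x - y` and `b = y - z` that sends `a` to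
`-a - b` and `b` to `a`. -/
def cycle (k : Type*) [Field k] : Module.End k (k × k) where
  toFun u := (u.2 - u.1, -u.1)
  map_add' u w := by ext <;> simp <;> ring
  map_smul' c u := by ext <;> simp <;> ring

@[simp] theorem cycle_apply (u : k × k) : cycle k u = (u.2 - u.1, -u.1) := rfl

theorem cycle_pow_three : cycle k ^ 3 = 1 := by
  ext <;> simp [pow_succ]

theorem sub_one_mem : (X 0 - X 1 : MvPolynomial (Fin 3) k) ∈ diagIdeal k :=
  Ideal.subset_span (by simp)

theorem sub_two_mem : (X 1 - X 2 : MvPolynomial (Fin 3) k) ∈ diagIdeal k :=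
  Ideal.subset_span (by simp)

theorem linForm_mem (u : k × k) : linForm u ∈ diagIdeal k :=
  add_mem (Ideal.mul_mem_left _ _ sub_one_mem) (Ideal.mul_mem_left _ _ sub_two_mem)

/-- Each component of the curl of the form is d + 2 times a single d-th power, which the
normalization cancels. -/
theorem vectorField_X (d : ℕ) (hd : (d : k) + 2 ≠ 0) :
    (jouanolou k d).vectorField (X 0) = X 2 ^ d ∧
    (jouanolou k d).vectorField (X 1) = X 0 ^ d ∧
    (jouanolou k d).vectorField (X 2) = X 1 ^ d := by
  have key : ∀ f : MvPolynomial (Fin 3) k,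
      ((d : k) + 2)⁻¹ • (f + ((d : MvPolynomial (Fin 3) k) + 1) * f) = f := by
    intro f
    have : f + ((d : MvPolynomial (Fin 3) k) + 1) * f = ((d : k) + 2) • f := by
      simp only [smul_eq_C_mul, map_add, map_natCast, map_ofNat]; ring
    rw [this, smul_smul, inv_mul_cancel₀ hd, one_smul]
  refine ⟨?_, ?_, ?_⟩ <;>
  · simp only [PlaneFoliation.vectorField, jouanolou, mkDerivation_X, jouanolouForm]
    simp [Derivation.leibniz, Derivation.leibniz_pow, pderiv_X]
    simpa using key _

theorem map_mem_diagIdeal_sq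
    (v : Derivation k (MvPolynomial (Fin 3) k) (MvPolynomial (Fin 3) k))
    (hv : ∀ f ∈ diagIdeal k, v f ∈ diagIdeal k) {f : MvPolynomial (Fin 3) k}
    (hf : f ∈ diagIdeal k ^ 2) : v f ∈ diagIdeal k ^ 2 := by
  rw [sq] at hf ⊢
  refine Submodule.mul_induction_on hf (fun g hg h hh => ?_) fun g h hg hh => ?_
  · rw [v.leibniz, smul_eq_mul, smul_eq_mul, mul_comm h]
    exact add_mem (Ideal.mul_mem_mul hg (hv h hh)) (Ideal.mul_mem_mul (hv g hg) hh)
  · rw [map_add]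
    exact add_mem hg hh

theorem pow_sub_pow_mem {f g : MvPolynomial (Fin 3) k} (h : f - g ∈ diagIdeal k) (n : ℕ) :
    f ^ n - g ^ n ∈ diagIdeal k :=
  Ideal.mem_of_dvd _ (sub_dvd_pow_sub_pow f g n) h

theorem pow_sub_pow_sub_mem_sq {f g : MvPolynomial (Fin 3) k} (h : f - g ∈ diagIdeal k)
    (e : ℕ) : f ^ (e + 1) - g ^ (e + 1) - C ((e : k) + 1) * g ^ e * (f - g) ∈
      diagIdeal k ^ 2 := by
  obtain ⟨c, hc⟩ := Polynomial.powAddExpansion g (f - g) (e + 1)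
  have : f ^ (e + 1) - g ^ (e + 1) - C ((e : k) + 1) * g ^ e * (f - g) = c * (f - g) ^ 2 := by
    rw [add_sub_cancel] at hc
    rw [hc]
    simp only [Nat.cast_add, Nat.cast_one, Nat.add_sub_cancel, map_add, map_natCast, map_one]
    ring
  rw [this]
  exact Ideal.mul_mem_left _ _ (Ideal.pow_mem_pow h 2)

/-! ### Linearization of the vector field along the diagonal -/

section Derivation

variable {e : ℕ} {v : Derivation k (MvPolynomial (Fin 3) k) (MvPolynomial (Fin 3) k)}
  (h0 : v (X 0) = X 2 ^ (e + 1)) (h1 : v (X 1) = X 0 ^ (e + 1)) (h2 : v (X 2) = X 1 ^ (e + 1))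

include h0 h1 h2 in
-- The vector field permutes the coordinates cyclically up to d-th powers, and those agree on the
-- diagonal.
theorem map_mem_diagIdeal {f : MvPolynomial (Fin 3) k} (hf : f ∈ diagIdeal k) :
    v f ∈ diagIdeal k := by
  refine Submodule.span_induction (fun g hg => ?_) (by simp)
    (fun g h _ _ hg hh => by rw [map_add]; exact add_mem hg hh) (fun c g hg hvg => ?_) hf
  · rcases hg with rfl | rfl
    · rw [map_sub, h0, h1, ← neg_mem_iff, neg_sub]
      refine pow_sub_pow_mem ?_ _
      simpa using add_mem (sub_one_mem (k := k)) sub_two_mem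
    · rw [map_sub, h1, h2]
      exact pow_sub_pow_mem sub_one_mem _
  · rw [smul_eq_mul, v.leibniz]
    exact add_mem (Ideal.mul_mem_left _ _ hvg) (Ideal.mul_mem_right _ _ hg)

include h0 h1 h2 in
theorem map_linForm_sub_mem (u : k × k) :
    v (linForm u) - C ((e : k) + 1) * X 2 ^ e * linForm (cycle k u) ∈ diagIdeal k ^ 2 := by
  have hx : (X 0 - X 2 : MvPolynomial (Fin 3) k) ∈ diagIdeal k := by
    simpa using add_mem (sub_one_mem (k := k)) sub_two_mem
  -- All d-th powers are compared with z^d, so that the first-order expansions share the factor z^e.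
  have h := sub_mem (Ideal.mul_mem_left _ (C (u.2 - u.1)) (pow_sub_pow_sub_mem_sq hx e))
    (Ideal.mul_mem_left _ (C u.2) (pow_sub_pow_sub_mem_sq (sub_two_mem (k := k)) e))
  convert h using 1
  simp only [linForm, cycle_apply, map_add, map_sub, map_neg, v.leibniz, h0, h1, h2,
    derivation_C, smul_eq_mul]
  ring

include h2 in
theorem map_pow_sub_mem (m : ℕ) :
    v (X 2 ^ m) - C (m : k) * X 2 ^ (m + e) ∈ diagIdeal k := by
  rcases m with _ | m
  · simp
  have h := Ideal.mul_mem_left _ (C ((m : k) + 1) * X 2 ^ m)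
    (pow_sub_pow_mem (sub_two_mem (k := k)) (e + 1))
  convert h using 1
  rw [v.leibniz_pow, h2]
  simp only [Nat.cast_add, Nat.cast_one, smul_eq_mul, nsmul_eq_mul, map_add, map_natCast, map_one,
    Nat.add_sub_cancel]
  ring

/-- The polynomial `∏ j < n, (T + j e)`. -/
noncomputable def risingProd (k : Type*) [Field k] (e n : ℕ) : Polynomial k :=
  ∏ j ∈ Finset.range n, (Polynomial.X + Polynomial.C ((j : k) * e))

theorem risingProd_succ (n : ℕ) : risingProd k e (n + 1) =
    (Polynomial.X + Polynomial.C ((n : k) * e)) * risingProd k e n := by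
  rw [risingProd, Finset.prod_range_succ, mul_comm, risingProd]

include h0 h1 h2 in
-- By Leibniz, the (n+1)-st application gives (e + 1)σ from the linear form and the scalar ne from
-- the prefactor z^(ne), which together form the next factor of `risingProd`.
theorem iterate_linForm_sub_mem (u : k × k) (n : ℕ) :
    v^[n] (linForm u) - X 2 ^ (n * e) *
      linForm (Polynomial.aeval (((e : k) + 1) • cycle k) (risingProd k e n) u) ∈
      diagIdeal k ^ 2 := by
  induction n with
  | zero => simp [risingProd]
  | succ n ih =>
    set w := Polynomial.aeval (((e : k) + 1) • cycle k) (risingProd k e n) u with hw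
    have hstep : Polynomial.aeval (((e : k) + 1) • cycle k) (risingProd k e (n + 1)) u =
        ((e : k) + 1) • cycle k w + ((n : k) * e) • w := by
      rw [risingProd_succ, map_mul, Module.End.mul_apply, ← hw, map_add, Polynomial.aeval_X,
        Polynomial.aeval_C, LinearMap.add_apply, LinearMap.smul_apply,
        Module.algebraMap_end_apply]
    have ih' := map_mem_diagIdeal_sq v (fun f hf => map_mem_diagIdeal h0 h1 h2 hf) ih
    have ha := Ideal.mul_mem_left _ (X 2 ^ (n * e)) (map_linForm_sub_mem h0 h1 h2 w)
    have hb := Ideal.mul_mem_mul (map_pow_sub_mem h2 (n * e)) (linForm_mem w)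
    rw [← sq] at hb
    convert add_mem (add_mem ih' ha) hb using 1
    rw [Function.iterate_succ_apply', hstep]
    simp only [linForm, map_sub, v.leibniz, smul_eq_mul, Prod.fst_add, Prod.snd_add,
      Prod.smul_fst, Prod.smul_snd, map_add, map_mul, Nat.cast_mul]
    ring

include h0 h1 h2 in
theorem iterate_X_two_sub_mem (n : ℕ) :
    v^[n] (X 2) - C ((risingProd k e n).eval 1) * X 2 ^ (n * e + 1) ∈ diagIdeal k := by
  induction n with
  | zero => simp [risingProd]
  | succ n ih =>
    have ih' := map_mem_diagIdeal h0 h1 h2 ih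
    have hb := Ideal.mul_mem_left _ (C ((risingProd k e n).eval 1))
      (map_pow_sub_mem h2 (n * e + 1))
    convert add_mem ih' hb using 1
    rw [Function.iterate_succ_apply', risingProd_succ]
    simp only [map_sub, v.leibniz, derivation_C, smul_eq_mul, Polynomial.eval_mul,
      Polynomial.eval_add, Polynomial.eval_X, Polynomial.eval_C, map_add, map_mul, map_one,
      Nat.cast_mul, Nat.cast_add, Nat.cast_one]
    ring

end Derivation

/-! ### Restriction to a curve transverse to the diagonal -/

/-- Evaluation along the curve `(1 + ε, 1, 1)`. -/
noncomputable def evalCurve (k : Type*) [Field k] :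
    MvPolynomial (Fin 3) k →ₐ[k] Polynomial k :=
  aeval ![1 + Polynomial.X, 1, 1]

@[simp] theorem evalCurve_zero : evalCurve k (X 0) = 1 + Polynomial.X := by simp [evalCurve]
@[simp] theorem evalCurve_one : evalCurve k (X 1) = 1 := by simp [evalCurve]
@[simp] theorem evalCurve_two : evalCurve k (X 2) = 1 := by simp [evalCurve]
@[simp] theorem evalCurve_C (c : k) : evalCurve k (C c) = Polynomial.C c := by
  simp [evalCurve]

theorem map_diagIdeal_le :
    (diagIdeal k).map (evalCurve k) ≤ Ideal.span {(Polynomial.X : Polynomial k)} := by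
  rw [diagIdeal, Ideal.map_span, Ideal.span_le]
  rintro _ ⟨f, rfl | rfl, rfl⟩ <;> simp

theorem X_pow_dvd_evalCurve {f : MvPolynomial (Fin 3) k} {n : ℕ} (hf : f ∈ diagIdeal k ^ n) :
    Polynomial.X ^ n ∣ evalCurve k f := by
  rw [← Ideal.mem_span_singleton, ← Ideal.span_singleton_pow]
  refine Ideal.pow_right_mono map_diagIdeal_le n ?_
  rw [← Ideal.map_pow]
  exact Ideal.mem_map_of_mem _ hf

theorem evalCurve_linForm (u : k × k) : evalCurve k (linForm u) =
    Polynomial.C u.1 * Polynomial.X := by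
  simp [linForm]

/-- The coefficient of `ε ^ 2` in the contraction along the curve `(1 + ε, 1, 1)` vanishes
when the contraction does. -/
theorem coeff_eq_zero_of_contraction_eq_zero {e : ℕ}
    {v : Derivation k (MvPolynomial (Fin 3) k) (MvPolynomial (Fin 3) k)}
    (h0 : v (X 0) = X 2 ^ (e + 1)) (h1 : v (X 1) = X 0 ^ (e + 1)) (h2 : v (X 2) = X 1 ^ (e + 1))
    (n : ℕ) (h : ∑ i, jouanolouForm k (e + 1) i * v^[n] (X i) = 0) :
    ((e : k) + 1) *
      ((Polynomial.aeval (((e : k) + 1) • cycle k) (risingProd k e n) (1, 0)).1 +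
      (Polynomial.aeval (((e : k) + 1) • cycle k) (risingProd k e n) (0, 1)).1) +
      (Polynomial.aeval (((e : k) + 1) • cycle k) (risingProd k e n) (0, 1)).1 -
      ((e : k) + 1) * (risingProd k e n).eval 1 = 0 := by
  have ha := X_pow_dvd_evalCurve (iterate_linForm_sub_mem h0 h1 h2 (1, 0) n)
  have hb := X_pow_dvd_evalCurve (iterate_linForm_sub_mem h0 h1 h2 (0, 1) n)
  have hc := X_pow_dvd_evalCurve (n := 1)
    (by simpa using iterate_X_two_sub_mem h0 h1 h2 n)
  have la : linForm ((1, 0) : k × k) = X 0 - X 1 := by simp [linForm]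
  have lb : linForm ((0, 1) : k × k) = X 1 - X 2 := by simp [linForm]
  rw [la, iterate_map_sub] at ha
  rw [lb, iterate_map_sub] at hb
  obtain ⟨ga, hga⟩ := ha
  obtain ⟨gb, hgb⟩ := hb
  obtain ⟨gc, hgc⟩ := hc
  generalize (Polynomial.aeval (((e : k) + 1) • cycle k) (risingProd k e n) (1, 0)) = Ka at *
  generalize (Polynomial.aeval (((e : k) + 1) • cycle k) (risingProd k e n) (0, 1)) = Kb at *
  generalize (risingProd k e n).eval 1 = c at *
  have hh := congrArg (evalCurve k) h
  obtain ⟨q, hq⟩ := Polynomial.powAddExpansion 1 (Polynomial.X : Polynomial k) (e + 1)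
  simp only [Fin.sum_univ_three, jouanolouForm, Matrix.cons_val_zero, Matrix.cons_val_one,
    Matrix.cons_val, map_add, map_mul, map_sub, map_pow, evalCurve_zero, evalCurve_one,
    evalCurve_two, evalCurve_C, evalCurve_linForm, one_pow, one_mul, mul_one, map_zero, pow_one,
    Nat.cast_add, Nat.cast_one] at hh hga hgb hgc hq
  rw [pow_succ (1 + Polynomial.X) (e + 1), hq] at hh
  generalize evalCurve k (v^[n] (X 0)) = w0 at *
  generalize evalCurve k (v^[n] (X 1)) = w1 at *
  generalize evalCurve k (v^[n] (X 2)) = w2 at *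
  obtain rfl := sub_eq_iff_eq_add.1 hgc
  obtain rfl := sub_eq_iff_eq_add.1 (sub_eq_iff_eq_add.1 hgb)
  obtain rfl := sub_eq_iff_eq_add.1 (sub_eq_iff_eq_add.1 hga)
  -- With w0 - w2 and w1 - w2 divisible by ε, the contraction is A(w0 - w2) + B(w1 - w2) + (A + B +
  -- C)w2. Here A and B are divisible by ε, and A + B + C = ε - ε(1 + ε)^d by ε², which yields the
  -- bracket.
  have hX : (Polynomial.X : Polynomial k) ^ 2 *
      (((e : Polynomial k) + 1 + Polynomial.X * q) *
        (Polynomial.C Ka.1 + Polynomial.C Kb.1 + Polynomial.X * (ga + gb)) +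
      (Polynomial.C Kb.1 + Polynomial.X * gb) -
      ((e : Polynomial k) + 1 + Polynomial.X * q) * (Polynomial.C c + Polynomial.X * gc)) = 0 := by
    rw [← hh]
    ring
  have hX' := congrArg (Polynomial.eval 0)
    ((mul_eq_zero.1 hX).resolve_left (pow_ne_zero 2 Polynomial.X_ne_zero))
  simpa using hX'

theorem cycle_pow_prime {p : ℕ} (hp : p.Prime) (hp3 : ¬ p ≡ 1 [MOD 3]) :
    p = 3 ∧ cycle k ^ p = 1 ∨ cycle k ^ p = cycle k ^ 2 := by
  have h := Nat.div_add_mod p 3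
  have hpow : cycle k ^ p = cycle k ^ (p % 3) := by
    conv_lhs => rw [← h, pow_add, pow_mul, cycle_pow_three, one_pow, one_mul]
  have h3 : p % 3 ≠ 1 := hp3
  have : p % 3 = 0 ∨ p % 3 = 2 := by omega
  rcases this with h0 | h0
  · left
    refine ⟨((Nat.prime_dvd_prime_iff_eq Nat.prime_three hp).1
      (Nat.dvd_of_mod_eq_zero h0)).symm, ?_⟩
    rw [hpow, h0, pow_zero]
  · right
    rw [hpow, h0]

end Jouanolou

/-! ### The ε² coefficient at the p-th iterate -/

open Jouanolou in
theorem mainTheorem9 (k : Type*) [Field k] [IsAlgClosed k] (p : ℕ) [CharP k p]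
    (hp : p.Prime) (hp2 : 2 < p) (hp3 : ¬ p ≡ 1 [MOD 3]) (d : ℕ) (hd : 1 < d)
    (hpd : ¬ p ∣ d * (d + 2) * (d ^ 2 + d + 1)) :
    ¬ (jouanolou k d).IsPClosed p := by
  intro hclosed
  have := Fact.mk hp
  obtain ⟨e, rfl⟩ : ∃ e, d = e + 1 := ⟨d - 1, by omega⟩
  have hne : ∀ m : ℕ, ¬ p ∣ m → (m : k) ≠ 0 :=
    fun m hm h => hm ((CharP.cast_eq_zero_iff k p m).1 h)
  have hd0 : (e : k) + 1 ≠ 0 := by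
    have := hne (e + 1) fun h => hpd (Dvd.dvd.mul_right (Dvd.dvd.mul_right h _) _)
    exact_mod_cast this
  have hd2 : (e : k) + 1 + 2 ≠ 0 := by
    have := hne (e + 1 + 2) fun h => hpd (Dvd.dvd.mul_right (Dvd.dvd.mul_left h _) _)
    exact_mod_cast this
  obtain ⟨h0, h1, h2⟩ := vectorField_X (k := k) (e + 1) (by exact_mod_cast hd2)
  have key := coeff_eq_zero_of_contraction_eq_zero h0 h1 h2 p hclosed
  have hfrob : ((e : k) + 1) ^ p = (e : k) + 1 := by
    rw [← frobenius_def, map_add, map_natCast, map_one]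
  rw [risingProd, prod_X_add_natCast_mul p hp (e : k)] at key
  -- Whether this power is 0 or 1 is irrelevant, since it cancels in both cases below.
  generalize (e : k) ^ (p - 1) = σ at key
  simp only [map_sub, map_mul, map_pow, Polynomial.aeval_X, Polynomial.aeval_C, smul_pow, hfrob,
    LinearMap.sub_apply, LinearMap.smul_apply, Module.End.mul_apply, Prod.fst_sub, Prod.smul_fst,
    Module.algebraMap_end_apply, cycle_apply, Polynomial.eval_sub, Polynomial.eval_mul,
    Polynomial.eval_pow, Polynomial.eval_X, Polynomial.eval_C, smul_eq_mul] at key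
  rcases cycle_pow_prime (k := k) hp hp3 with ⟨rfl, h⟩ | h
  · have h3 : (3 : k) = 0 := by exact_mod_cast CharP.cast_eq_zero k 3
    simp only [h, Module.End.one_apply] at key
    -- The coefficient is d(d - 1), which equals d(d + 2) in characteristic 3.
    refine mul_ne_zero hd0 hd2 ?_
    linear_combination key + (e + 1) * h3
  · simp only [h, sq, Module.End.mul_apply, cycle_apply] at key
    -- With σ^p = σ² the coefficient is -d(d + 2).
    refine mul_ne_zero hd0 hd2 ?_
    linear_combination -key
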